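/- **Definitions.** A *median algebra* is a set $M$ with a map $m:M^3\to M$ satisfying $m(x,y,z)=m(x,z,y)=m(y,z,x)$, $m(x,x,y)=x$ and $m(m(x,y,z),u,v)=m(x,m(y,u,v),m(z,u,v))$; all median algebras below are non-empty, and groups act on them by bijections preserving $m$. A subset $C\subseteq M$ is *convex* if $m(x,y,z)\in C$ for all $x,y\in C$, $z\in M$. A *half space* is a convex set $H$ whose complement $H^*=M\setminus H$ is convex; it is *proper* if $H\neq\emptyset,M$. $M$ is *discrete* if for all $x,y\in M$ the set $\Delta(x,y)$ of half spaces containing $x$ but not $y$ is finite; then $d(x,y)=|\Delta(x,y)|$ is a metric, and a subset of $M$ is *bounded* if it has finite diameter for $d$. Let a group $G$ act on a discrete median algebra $M$. The action is *elliptic* if some orbit $Gx$ is bounded. $M$ is *simple* (with respect to $G$) if for any two proper half spaces $H,J$ there is $g\in G$ with $J=gH$ or $J^*=gH$. A half space $H$ *cuts $M$ properly* if for every $x\in M$ both $H\cap Gx$ and $H^*\cap Gx$ are unbounded; $H$ is *essential* if it cuts $M$ properly and its orbit $GH$ is infinite. The action is *essential* if there is an essential half space. $G_H=\{g\in G: gH=H\}$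 is the stabilizer of $H$. For a subgroup $K\le G$ let $\mathcal P$ be the $\mathbb F_2$-vector space of subsets $A\subseteq G$ with $KA=A$ (addition is symmetric difference), with $G$ acting by right multiplication, and let $\mathcal F\subseteq\mathcal P$ be the submodule of sets $KF$ with $F\subseteq G$ finite. Put $e(G,K)=\dim_{\mathbb F_2}(\mathcal P/\mathcal F)^G$. **Theorem 11.5.** Let $G$ be a group. The following are equivalent. (a) There is a subgroup $K\le G$ with $e(G,K)>1$. (b) $G$ admits a non-elliptic action on a simple discrete median algebra. (c) $G$ admits an essential action on a discrete median algebra. Moreover, if $M$ is a discrete median algebra with a $G$-action, then $e(G,G_H)>1$ for every proper half space $H$ of $M$ when $M$ is simple and the action is non-elliptic, and $e(G,G_H)>1$ for every essential half space $H$ of $M$ without any further assumption. Conversely, if $K\le G$ is a subgroup with $e(G,K)>1$, then there exist a simple discrete median algebra $M$ with a non-elliptic $G$-action and a proper half space $H$ of $M$ which is essential, such that $G_H$ contains $K$ as a subgroup of finite index. -/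

import Mathlib

open scoped Pointwise

universe u v

/-! ## Median algebras, half spaces and the median metric -/

/-- A median algebra: a set with a symmetric ternary operation satisfying the three median
axioms. (The empty set is not excluded here; non-emptiness is required where it is used.) -/
class MedianAlgebra (M : Type v) where
  med : M → M → M → M
  med_swap : ∀ x y z, med x y z = med x z y
  med_rotate : ∀ x y z, med x y z = med y z x
  med_self : ∀ x y, med x x y = x
  med_distrib : ∀ x y z s t, med (med x y z) s t = med x (med y s t) (med z s t)

namespace MedianAlgebra

section Basic

variable {M : Type v} [MedianAlgebra M]

/-- The interval `[x, y] = {z | z = m(x, y, z)}`. -/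
def interval (x y : M) : Set M := {z | z = med x y z}

/-- Convex subsets contain the interval between any two of their points. -/
def IsConvex (C : Set M) : Prop := ∀ x ∈ C, ∀ y ∈ C, interval x y ⊆ C

/-- Half spaces are convex sets with convex complement; `∅` and `M` are included. -/
def IsHalfSpace (H : Set M) : Prop := IsConvex H ∧ IsConvex Hᶜ

/-- Proper half spaces are those different from `∅` and `M`. -/
def IsProperHalfSpace (H : Set M) : Prop := IsHalfSpace H ∧ H ≠ ∅ ∧ H ≠ Set.univ

/-- The separator `Δ(x, y)`: all half spaces containing `x` but not `y`. -/
def separator (x y : M) : Set (Set M) := {H | IsHalfSpace H ∧ x ∈ H ∧ y ∉ H}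

variable (M) in
/-- `M` is discrete if all separators `Δ(x, y)` are finite. -/
def IsDiscrete : Prop := ∀ x y : M, (separator x y).Finite

/-- The median metric `d(x, y) = |Δ(x, y)|` (meaningful for discrete `M`). -/
noncomputable def dist (x y : M) : ℕ := (separator x y).ncard

/-- Subsets of bounded diameter in the median metric. -/
def IsBdd (X : Set M) : Prop := ∃ N : ℕ, ∀ x ∈ X, ∀ y ∈ X, dist x y ≤ N

end Basic

/-! ## Group actions on median algebras -/

section Action

variable (G : Type u) [Group G] (M : Type v) [MedianAlgebra M] [MulAction G M]

/-- The group acts by median automorphisms. -/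
def IsMedianAction : Prop :=
  ∀ (g : G) (x y z : M), g • med x y z = med (g • x) (g • y) (g • z)

/-- `M` is simple as a `G`-median algebra: `G` is transitive on the hyperplanes `{H, Hᶜ}`. -/
def IsSimple : Prop :=
  ∀ H J : Set M, IsProperHalfSpace H → IsProperHalfSpace J → ∃ g : G, J = g • H ∨ Jᶜ = g • H

/-- The action is elliptic if some orbit is bounded. -/
def IsElliptic : Prop := ∃ x : M, IsBdd (MulAction.orbit G x)

variable {M} in
/-- `H` cuts `M` properly: `H` and its complement meet every orbit in an unbounded set. -/
def CutsProperly (H : Set M) : Prop :=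
  ∀ x : M, ¬ IsBdd (H ∩ MulAction.orbit G x) ∧ ¬ IsBdd (Hᶜ ∩ MulAction.orbit G x)

variable {M} in
/-- A half space is essential if it cuts properly and has an infinite orbit. -/
def IsEssentialHalfSpace (H : Set M) : Prop :=
  IsHalfSpace H ∧ CutsProperly G H ∧ (MulAction.orbit G H).Infinite

/-- The action is essential if there is an essential half space. -/
def IsEssential : Prop := ∃ H : Set M, IsEssentialHalfSpace G H

end Action

end MedianAlgebra

/-! ## Ends of pairs of groups -/

namespace GroupPair

variable {G : Type u} [Group G] (K : Subgroup G)

/-- The `𝔽₂`-module of all subsets `A` of `G` with `K A = A`, a subset being identified with its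
indicator function `G → 𝔽₂`, so that addition is the symmetric difference. -/
def invariantSets : Submodule (ZMod 2) (G → ZMod 2) where
  carrier := {f | ∀ k ∈ K, ∀ x, f (k * x) = f x}
  zero_mem' := fun _ _ _ => rfl
  add_mem' := fun {a b} ha hb k hk x => by
    simp only [Pi.add_apply, ha k hk x, hb k hk x]
  smul_mem' := fun c a ha k hk x => by
    simp only [Pi.smul_apply, ha k hk x]

/-- `A` is `K`-finite if `A = K F` for some finite set `F`. -/
def IsKFinite (f : G → ZMod 2) : Prop :=
  ∃ F : Set G, F.Finite ∧ Function.support f = (K : Set G) * F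

theorem isKFinite_of_subset {f : G → ZMod 2} (hf : f ∈ invariantSets K) {F : Set G}
    (hF : F.Finite) (h : Function.support f ⊆ (K : Set G) * F) : IsKFinite K f := by
  refine ⟨F ∩ Function.support f, hF.inter_of_left _, Set.Subset.antisymm ?_ ?_⟩
  · intro x hx
    obtain ⟨k, hk, y, hy, rfl⟩ := h hx
    refine ⟨k, hk, y, ⟨hy, ?_⟩, rfl⟩
    have h1 : f (k * y) = f y := hf k hk y
    have h2 : f (k * y) ≠ 0 := hx
    rw [h1] at h2
    exact h2
  · rintro _ ⟨k, hk, y, ⟨_, hy⟩, rfl⟩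
    have h1 : f (k * y) = f y := hf k hk y
    change f (k * y) ≠ 0
    rw [h1]
    exact hy

/-- The submodule of `K`-finite sets. -/
def finiteSets : Submodule (ZMod 2) (invariantSets K) where
  carrier := {f | IsKFinite K f.1}
  zero_mem' := ⟨∅, Set.finite_empty, by simp⟩
  add_mem' := fun {a b} ⟨F₁, h₁, e₁⟩ ⟨F₂, h₂, e₂⟩ => by
    refine isKFinite_of_subset K (a + b).2 (h₁.union h₂) ?_
    rw [Set.mul_union, ← e₁, ← e₂]
    exact Function.support_add _ _
  smul_mem' := fun c a ⟨F, h, e⟩ => by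
    refine isKFinite_of_subset K (c • a).2 h ?_
    rw [← e]
    exact Function.support_const_smul_subset c a.1

/-- Right multiplication `A ↦ A g` on `K`-invariant sets (`x ∈ A g` iff `x g⁻¹ ∈ A`). -/
def rightMul (g : G) : invariantSets K →ₗ[ZMod 2] invariantSets K where
  toFun f := ⟨fun x => f.1 (x * g⁻¹), fun k hk x => by
    have h := f.2 k hk (x * g⁻¹)
    rwa [← mul_assoc] at h⟩
  map_add' _ _ := rfl
  map_smul' _ _ := rfl

theorem finiteSets_le_comap (g : G) : finiteSets K ≤ (finiteSets K).comap (rightMul K g) := by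
  rintro f ⟨F, hF, e⟩
  refine isKFinite_of_subset K (rightMul K g f).2 (hF.image (fun y => y * g)) ?_
  intro x hx
  have hx' : x * g⁻¹ ∈ Function.support f.1 := hx
  rw [e] at hx'
  obtain ⟨k, hk, y, hy, h⟩ := hx'
  refine ⟨k, hk, y * g, ⟨y, hy, rfl⟩, ?_⟩
  have h' : k * y = x * g⁻¹ := h
  change k * (y * g) = x
  rw [← mul_assoc, h', inv_mul_cancel_right]

/-- The induced right action of `g` on the quotient by the `K`-finite sets. -/
def rightMulQuot (g : G) :
    (invariantSets K ⧸ finiteSets K) →ₗ[ZMod 2] (invariantSets K ⧸ finiteSets K) :=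
  (finiteSets K).mapQ (finiteSets K) (rightMul K g) (finiteSets_le_comap K g)

/-- The submodule of `G`-fixed elements of the quotient. -/
def fixedClasses : Submodule (ZMod 2) (invariantSets K ⧸ finiteSets K) :=
  ⨅ g : G, LinearMap.eqLocus (rightMulQuot K g) LinearMap.id

/-- The number of ends `e(G, K)`: the dimension over `𝔽₂` of the module of `G`-fixed elements. -/
noncomputable def ends : Cardinal.{u} := Module.rank (ZMod 2) (fixedClasses K)

end GroupPair

/-!
The argument rests on a reformulation of `e(G, K) > 1`: the coset space `G ⧸ K` has a subset `V`
that is infinite and coinfinite and for which all symmetric differences `V ∆ g V` are finite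
(`GroupPair.one_lt_ends_iff`).

Given a half space `H` of a discrete median algebra with stabilizer `K`, the coset space is the
orbit `G H`, and `V` is the set of translates of `H` through a base point `x`. The difference
`V ∆ g V` consists of half spaces separating `x` from `g x`, so that it is finite, and it remains to
see that infinitely many translates of `H`, and of its complement, contain `x`.
* If the algebra is simple, every proper half space is a translate of `H` or of its complement, so
  finitely many translates through `x` would bound the orbit of `x`
  (`MedianAlgebra.IsSimple.infinite_translatesThrough`).
* If `H` is essential and only finitely many translates pass through each point, take a point where
  their number is minimal. A root (as in a `Δ`-system) of the infinite family of finite sets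
  obtained along its orbit yields three points whose median lies in fewer translates
  (`MedianAlgebra.infinite_translatesThrough`).

In a simple algebra with non-elliptic action every proper half space is essential
(`MedianAlgebra.IsSimple.isEssentialHalfSpace`), hence for the converse it suffices to construct
such an algebra. Given `V ⊆ G ⧸ K`, take all subsets of `G ⧸ K` that differ from `V` by finitely
many elements, with majority as median. Its proper half spaces are the conditions `q ∈ U` and
`q ∉ U` for the points `q` (`CommensurabilityClass.exists_eq_coord`), which makes it simple and
discrete, and the half space of the trivial coset has stabilizer `K`. A bounded orbit would give a
`G`-invariant subset of `G ⧸ K` commensurable to `V`, by `exists_invariant_of_bounded`; but the only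
invariant subsets are `∅` and `G ⧸ K`, whereas `V` is infinite and coinfinite.
-/

open scoped symmDiff

/-! ### Ends of pairs in terms of coset spaces -/

namespace GroupPair

variable {G : Type u} [Group G] (K : Subgroup G)

/-- The subset `{a K | f a⁻¹ ≠ 0}` of `G ⧸ K` corresponding to a left `K`-invariant function `f`,
i.e. to the subset `support f` of `K \ G`. Inversion turns right into left multiplication. -/
def cosetSet (f : G → ZMod 2) : Set (G ⧸ K) := {q | ∃ a : G, (a : G ⧸ K) = q ∧ f a⁻¹ ≠ 0}

variable {K}

theorem mk_mem_cosetSet {f : G → ZMod 2} (hf : f ∈ invariantSets K) (a : G) :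
    (a : G ⧸ K) ∈ cosetSet K f ↔ f a⁻¹ ≠ 0 := by
  refine ⟨?_, fun h => ⟨a, rfl, h⟩⟩
  rintro ⟨b, hb, hfb⟩
  have hk : b⁻¹ * a ∈ K := QuotientGroup.eq.1 hb
  have h := hf _ hk a⁻¹
  rw [mul_inv_cancel_right] at h
  rwa [← h]

theorem isKFinite_iff {f : G → ZMod 2} (hf : f ∈ invariantSets K) :
    IsKFinite K f ↔ (cosetSet K f).Finite := by
  constructor
  · rintro ⟨F, hF, e⟩
    refine (hF.image fun y => ((y⁻¹ : G) : G ⧸ K)).subset ?_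
    rintro _ ⟨a, rfl, ha⟩
    have ha' : a⁻¹ ∈ Function.support f := ha
    rw [e] at ha'
    obtain ⟨k, hk, y, hy, h⟩ := ha'
    refine ⟨y, hy, QuotientGroup.eq.2 ?_⟩
    have h' : k * y = a⁻¹ := h
    have : y⁻¹⁻¹ * a = k⁻¹ := by
      rw [← inv_inv a, ← h']; group
    rw [this]
    exact K.inv_mem hk
  · intro h
    refine isKFinite_of_subset K hf (h.image fun q => (Quotient.out q)⁻¹) ?_
    intro x hx
    have hx' : ((x⁻¹ : G) : G ⧸ K) ∈ cosetSet K f := by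
      rw [mk_mem_cosetSet hf, inv_inv]; exact hx
    refine ⟨x * Quotient.out ((x⁻¹ : G) : G ⧸ K), ?_, _, ⟨_, hx', rfl⟩, by simp⟩
    have := QuotientGroup.eq.1 (QuotientGroup.out_eq' ((x⁻¹ : G) : G ⧸ K)).symm
    simpa using this

theorem cosetSet_rightMul_sub (f : invariantSets K) (g : G) :
    cosetSet K (rightMul K g f - f).1 = cosetSet K f.1 ∆ (g⁻¹ • cosetSet K f.1) := by
  ext q
  induction q using QuotientGroup.induction_on with
  | H a =>
    rw [mk_mem_cosetSet (rightMul K g f - f).2, Set.mem_symmDiff, Set.mem_inv_smul_set_iff,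
      MulAction.Quotient.smul_coe, mk_mem_cosetSet f.2, mk_mem_cosetSet f.2]
    change f.1 (a⁻¹ * g⁻¹) - f.1 a⁻¹ ≠ 0 ↔ _
    rw [smul_eq_mul, mul_inv_rev]
    generalize f.1 (a⁻¹ * g⁻¹) = s
    generalize f.1 a⁻¹ = t
    revert s t
    decide

theorem mkQ_mem_fixedClasses_iff (f : invariantSets K) :
    (finiteSets K).mkQ f ∈ fixedClasses K ↔
      ∀ g : G, (cosetSet K f.1 ∆ (g • cosetSet K f.1)).Finite := by
  have key : ∀ g : G, rightMulQuot K g ((finiteSets K).mkQ f) = (finiteSets K).mkQ f ↔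
      (cosetSet K f.1 ∆ (g⁻¹ • cosetSet K f.1)).Finite := fun g => by
    rw [← cosetSet_rightMul_sub, ← isKFinite_iff (rightMul K g f - f).2]
    exact Submodule.Quotient.eq _
  simp only [fixedClasses, Submodule.mem_iInf, LinearMap.mem_eqLocus, LinearMap.id_apply, key]
  exact ⟨fun h g => by simpa using h g⁻¹, fun h g => h g⁻¹⟩

theorem mkQ_eq_zero_iff (f : invariantSets K) :
    (finiteSets K).mkQ f = 0 ↔ (cosetSet K f.1).Finite := by
  rw [← isKFinite_iff f.2]
  exact Submodule.Quotient.mk_eq_zero _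

variable (K) in
/-- The set `G` itself, as a `K`-invariant set. -/
def univSet : invariantSets K := ⟨fun _ => 1, fun _ _ _ => rfl⟩

theorem cosetSet_univSet : cosetSet K (univSet K).1 = Set.univ := by
  ext q
  induction q using QuotientGroup.induction_on with
  | H a =>
    rw [mk_mem_cosetSet (univSet K).2]
    exact iff_of_true one_ne_zero trivial

theorem cosetSet_univSet_sub (f : invariantSets K) :
    cosetSet K (univSet K - f).1 = (cosetSet K f.1)ᶜ := by
  ext q
  induction q using QuotientGroup.induction_on with
  | H a =>
    rw [mk_mem_cosetSet (univSet K - f).2, Set.mem_compl_iff, mk_mem_cosetSet f.2]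
    change 1 - f.1 a⁻¹ ≠ 0 ↔ _
    generalize f.1 a⁻¹ = t
    revert t
    decide

theorem exists_cosetSet_eq (V : Set (G ⧸ K)) : ∃ f : invariantSets K, cosetSet K f.1 = V := by
  classical
  have hf : (fun x : G => if ((x⁻¹ : G) : G ⧸ K) ∈ V then (1 : ZMod 2) else 0) ∈
      invariantSets K := fun k hk x => by
    have : (((k * x)⁻¹ : G) : G ⧸ K) = ((x⁻¹ : G) : G ⧸ K) := by
      rw [QuotientGroup.eq]; simpa using hk
    simp only [this]
  refine ⟨⟨_, hf⟩, ?_⟩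
  ext q
  induction q using QuotientGroup.induction_on with
  | H a => simp [mk_mem_cosetSet hf]

/-- `e(G, K) > 1` means that `G ⧸ K` has a subset that is infinite and coinfinite and is moved by
each element of `G` only by a finite amount: over `𝔽₂`, a space of dimension at most one consists
of `0` and the class of `G`. -/
theorem one_lt_ends_iff : 1 < ends K ↔
    ∃ V : Set (G ⧸ K), (∀ g : G, (V ∆ (g • V)).Finite) ∧ V.Infinite ∧ Vᶜ.Infinite := by
  rw [← not_le, ends, rank_le_one_iff]
  constructor
  · intro h
    by_contra! hV
    refine h ⟨⟨(finiteSets K).mkQ (univSet K), ?_⟩, ?_⟩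
    · rw [mkQ_mem_fixedClasses_iff, cosetSet_univSet]
      intro g
      simp
    · rintro ⟨v, hv⟩
      obtain ⟨f, rfl⟩ := (finiteSets K).mkQ_surjective v
      have hv' := (mkQ_mem_fixedClasses_iff f).1 hv
      by_cases hfin : (cosetSet K f.1).Finite
      · exact ⟨0, Subtype.ext (by simpa using ((mkQ_eq_zero_iff f).2 hfin).symm)⟩
      · refine ⟨1, Subtype.ext ?_⟩
        have h1 := hV _ hv' hfin
        rw [← cosetSet_univSet_sub, ← mkQ_eq_zero_iff, map_sub,
          sub_eq_zero] at h1
        simpa using h1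
  · rintro ⟨V, hV, hinf, hcinf⟩ ⟨v₀, hv₀⟩
    obtain ⟨f, rfl⟩ := exists_cosetSet_eq V
    have hu : (finiteSets K).mkQ (univSet K) ∈ fixedClasses K := by
      rw [mkQ_mem_fixedClasses_iff, cosetSet_univSet]
      intro g
      simp
    obtain ⟨r, hr⟩ := hv₀ ⟨_, (mkQ_mem_fixedClasses_iff f).2 hV⟩
    obtain ⟨s, hs⟩ := hv₀ ⟨_, hu⟩
    have hr0 : r ≠ 0 := by
      rintro rfl
      rw [zero_smul] at hr
      exact hinf ((mkQ_eq_zero_iff f).1 (congrArg Subtype.val hr).symm)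
    have hs0 : s ≠ 0 := by
      rintro rfl
      rw [zero_smul] at hs
      have := (mkQ_eq_zero_iff (univSet K)).1 (congrArg Subtype.val hs).symm
      rw [cosetSet_univSet] at this
      exact hinf (this.subset (Set.subset_univ _))
    have hrs : s = r := by clear hr hs; revert r s; decide
    have h1 : (finiteSets K).mkQ (univSet K) = (finiteSets K).mkQ f :=
      congrArg Subtype.val ((hs.symm.trans (by rw [hrs])).trans hr)
    rw [← sub_eq_zero, ← map_sub, mkQ_eq_zero_iff, cosetSet_univSet_sub] at h1
    exact hcinf h1

end GroupPair

/-! ### Infinite families of finite sets -/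

section InfiniteFamilies

variable {X : Type*}

/-- An infinite family of finite sets of bounded size has a root `R`: infinitely many members
contain `R` and otherwise avoid any prescribed finite set. -/
theorem exists_root_of_infinite [DecidableEq X] {T : Set (Finset X)} (hT : T.Infinite) {D : ℕ}
    (hD : ∀ t ∈ T, t.card ≤ D) :
    ∃ R : Finset X, ∀ Y : Finset X, {t ∈ T | R ⊆ t ∧ Disjoint (t \ R) Y}.Infinite := by
  classical
  let P : ℕ → Prop := fun n => ∃ R : Finset X, R.card = n ∧ {t ∈ T | R ⊆ t}.Infinite
  have hP : ∀ n, P n → n ≤ D := by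
    rintro _ ⟨R, rfl, hR⟩
    obtain ⟨t, ht, hRt⟩ := hR.nonempty
    exact (Finset.card_le_card hRt).trans (hD t ht)
  have h0 : P 0 := ⟨∅, rfl, by simpa using hT⟩
  obtain ⟨R, hRn, hR⟩ : P (Nat.findGreatest P D) := Nat.findGreatest_spec (Nat.zero_le D) h0
  refine ⟨R, fun Y => ?_⟩
  -- By maximality of `R`, only finitely many members contain `R` and a further given point.
  have hfin : (⋃ y ∈ Y \ R, {t ∈ T | insert y R ⊆ t}).Finite := by
    refine Set.Finite.biUnion (Y \ R).finite_toSet fun y hy => ?_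
    by_contra hinf
    have hy' : y ∉ R := (Finset.mem_sdiff.1 hy).2
    have hc : P (Nat.findGreatest P D + 1) :=
      ⟨insert y R, by rw [Finset.card_insert_of_notMem hy', hRn], hinf⟩
    exact absurd (Nat.le_findGreatest (hP _ hc) hc) (by omega)
  refine (hR.sdiff hfin).mono ?_
  rintro t ⟨⟨ht, hRt⟩, hn⟩
  refine ⟨ht, hRt, Finset.disjoint_left.2 fun y hyt hyY => hn ?_⟩
  rw [Finset.mem_sdiff] at hyt
  exact Set.mem_biUnion (Finset.mem_sdiff.2 ⟨hyY, hyt.2⟩)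
    ⟨ht, Finset.insert_subset hyt.1 hRt⟩

end InfiniteFamilies

theorem symmDiff_union_subset_symmDiff {X : Type*} {A B E F : Set X} (hE : Disjoint E (A ∆ B))
    (hF : Disjoint F (A ∆ B ∪ E)) : A ∆ B ∪ E ⊆ (A ∆ E) ∆ (B ∆ F) := by
  intro x hx
  have hxF : x ∉ F := fun h => Set.disjoint_left.1 hF h hx
  have hxE : x ∈ E → x ∉ A ∆ B := fun h => Set.disjoint_left.1 hE h
  simp only [Set.mem_union, Set.mem_symmDiff] at hx hxE ⊢
  tauto

/-! ### Sets with boundedly close translates -/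

section BoundedOrbits

variable {G X : Type*} [Group G] [MulAction G X]

/-- If the orbit of `V` is finite and commensurable to `V`, the intersection of its members is
invariant and commensurable to `V`. -/
theorem exists_invariant_of_finite_orbit {V : Set X} (hV : ∀ g : G, (V ∆ (g • V)).Finite)
    (hfin : (MulAction.orbit G V).Finite) :
    ∃ W : Set X, (V ∆ W).Finite ∧ ∀ g : G, g • W = W := by
  refine ⟨⋂ U ∈ MulAction.orbit G V, U, ?_, ?_⟩
  · refine (Set.Finite.biUnion (t := fun U => V ∆ U) hfin ?_).subset ?_
    · rintro _ ⟨g, rfl⟩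
      exact hV g
    · rintro x (⟨hx, hx'⟩ | ⟨hx, hx'⟩)
      · simp only [Set.mem_iInter, not_forall] at hx'
        obtain ⟨U, hU, hxU⟩ := hx'
        exact Set.mem_biUnion hU (Or.inl ⟨hx, hxU⟩)
      · exact absurd (Set.mem_iInter₂.1 hx V (MulAction.mem_orbit_self V)) hx'
  · intro g
    ext x
    simp only [Set.mem_smul_set_iff_inv_smul_mem, Set.mem_iInter]
    constructor
    · intro h U hU
      have := h (g⁻¹ • U) (MulAction.mem_orbit_of_mem_orbit g⁻¹ hU)
      simpa using this
    · intro h U hU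
      have := h (g • U) (MulAction.mem_orbit_of_mem_orbit g hU)
      simpa [Set.mem_smul_set_iff_inv_smul_mem] using this

/-- A subset whose translates differ from it by a bounded number of points is commensurable to an
invariant subset. By induction on the bound: if the orbit is infinite and `R` is a root of the
family of sets `V ∆ g V`, then the set `V ∆ R`, a limit of translates of `V`, has a smaller
bound. -/
theorem exists_invariant_of_bounded (D : ℕ) (V : Set X)
    (hV : ∀ g : G, (V ∆ (g • V)).encard ≤ D) :
    ∃ W : Set X, (V ∆ W).Finite ∧ ∀ g : G, g • W = W := by
  classical
  induction D using Nat.strong_induction_on generalizing V with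
  | _ D ih =>
  have hVfin : ∀ g : G, (V ∆ (g • V)).Finite := fun g => Set.finite_of_encard_le_coe (hV g)
  by_cases hfin : (MulAction.orbit G V).Finite
  · exact exists_invariant_of_finite_orbit hVfin hfin
  let τ : G → Finset X := fun g => (hVfin g).toFinset
  have hτ : ∀ g, (τ g : Set X) = V ∆ (g • V) := fun g => (hVfin g).coe_toFinset
  have hinf : (Set.range τ).Infinite := by
    intro h
    refine hfin ((h.image fun t : Finset X => V ∆ (t : Set X)).subset ?_)
    rintro _ ⟨g, rfl⟩
    exact ⟨_, ⟨g, rfl⟩, by simp only [hτ, symmDiff_symmDiff_cancel_left]⟩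
  have hcard : ∀ t ∈ Set.range τ, t.card ≤ D := by
    rintro _ ⟨g, rfl⟩
    have := hV g
    rw [← hτ, Set.encard_coe_eq_coe_finsetCard] at this
    exact_mod_cast this
  obtain ⟨R, hR⟩ := exists_root_of_infinite hinf hcard
  obtain ⟨V', hV'⟩ : ∃ V' : Set X, V' = V ∆ (R : Set X) := ⟨_, rfl⟩
  -- A translate of `V` is `V ∆ R` altered on a set `E` away from a given finite set.
  have hE : ∀ Y : Set X, Y.Finite → ∃ (g : G) (E : Set X), g • V = V' ∆ E ∧
      E.Nonempty ∧ E.Finite ∧ Disjoint E Y := by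
    intro Y hY
    obtain ⟨t, ⟨⟨g, rfl⟩, hRt, hd⟩, hne⟩ :=
      ((hR hY.toFinset).sdiff (Set.finite_singleton R)).nonempty
    refine ⟨g, ((τ g \ R : Finset X) : Set X), ?_, ?_, Finset.finite_toSet _, ?_⟩
    · have h1 : (R : Set X) ∆ ((τ g \ R : Finset X) : Set X) = τ g := by
        rw [Finset.coe_sdiff]
        have : (R : Set X) ⊆ τ g := Finset.coe_subset.2 hRt
        rw [symmDiff_sdiff_eq_sup]
        exact sup_eq_right.2 this
      rw [hV', symmDiff_assoc, h1, hτ, symmDiff_symmDiff_cancel_left]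
    · rw [Finset.coe_nonempty, Finset.sdiff_nonempty]
      exact fun h => hne (Finset.Subset.antisymm h hRt)
    · rw [Set.disjoint_left]
      intro x hx hxY
      exact Finset.disjoint_left.1 hd (Finset.mem_coe.1 hx) (hY.mem_toFinset.2 hxY)
  have hVV' : (V ∆ V').Finite := by
    rw [hV', symmDiff_symmDiff_cancel_left]; exact R.finite_toSet
  have hV'fin : ∀ h : G, (V' ∆ (h • V')).Finite := by
    intro h
    have h1 : V' ∆ (h • V') ⊆ (V ∆ V') ∪ (V ∆ (h • V)) ∪ h • (V ∆ V') := by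
      rw [Set.smul_set_symmDiff (s := V), symmDiff_comm V V']
      exact (symmDiff_triangle V' V (h • V')).trans (Set.union_subset
        (Set.subset_union_left.trans Set.subset_union_left)
        ((symmDiff_triangle V (h • V) (h • V')).trans
          (Set.union_subset_union_left _ Set.subset_union_right)))
    exact ((hVV'.union (hVfin h)).union hVV'.smul_set).subset h1
  have hbound : ∀ h : G, (V' ∆ (h • V')).encard + 1 ≤ D := by
    intro h
    obtain ⟨g₁, E₁, hg₁, hne, hE₁, hd₁⟩ := hE _ (hV'fin h)
    obtain ⟨g₂, E₂, hg₂, -, -, hd₂⟩ :=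
      hE (h⁻¹ • ((V' ∆ (h • V')) ∪ E₁)) ((hV'fin h).union hE₁).smul_set
    have hd₂' : Disjoint (h • E₂) ((V' ∆ (h • V')) ∪ E₁) := by
      rw [Set.disjoint_left] at hd₂ ⊢
      intro x hx hx'
      refine hd₂ (Set.mem_smul_set_iff_inv_smul_mem.1 hx) ?_
      rwa [Set.smul_mem_smul_set_iff]
    have hsub : (V' ∆ (h • V')) ∪ E₁ ⊆ (g₁ • V) ∆ (h • g₂ • V) := by
      rw [hg₁, hg₂, Set.smul_set_symmDiff (s := V')]
      exact symmDiff_union_subset_symmDiff hd₁ hd₂'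
    calc (V' ∆ (h • V')).encard + 1 ≤ (V' ∆ (h • V')).encard + E₁.encard := by
          gcongr
          exact Set.one_le_encard_iff_nonempty.2 hne
      _ = ((V' ∆ (h • V')) ∪ E₁).encard := (Set.encard_union_eq hd₁.symm).symm
      _ ≤ ((g₁ • V) ∆ (h • g₂ • V)).encard := Set.encard_le_encard hsub
      _ = (g₁ • (V ∆ ((g₁⁻¹ * h * g₂) • V))).encard := by
          rw [Set.smul_set_symmDiff, mul_assoc, mul_smul g₁⁻¹, smul_inv_smul, mul_smul]
      _ ≤ D := by
          rw [Set.encard_smul_set]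
          exact hV _
  obtain ⟨D', rfl⟩ : ∃ D', D = D' + 1 := by
    refine Nat.exists_eq_succ_of_ne_zero ?_
    rintro rfl
    simpa using hbound 1
  obtain ⟨W, hW, hinv⟩ := ih D' (Nat.lt_succ_self _) V' fun h => by
    have := hbound h
    push_cast at this
    exact (ENat.add_le_add_iff_right (by simp)).1 this
  exact ⟨W, (hVV'.union hW).subset (symmDiff_triangle V V' W), hinv⟩

end BoundedOrbits

/-! ### Half spaces and their translates -/

namespace MedianAlgebra

section HalfSpaces

variable {M : Type v} [MedianAlgebra M]

theorem med_med_self (x y z : M) : med x y (med x y z) = med x y z := by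
  have h := med_distrib z x y x y
  rw [med_self x y, med_swap y x y, med_rotate y y x, med_swap y x y, med_self y x] at h
  rwa [med_rotate x y (med x y z), med_rotate y (med x y z) x, ← med_rotate z x y]

theorem IsConvex.med_mem {C : Set M} (hC : IsConvex C) {x y : M} (hx : x ∈ C) (hy : y ∈ C)
    (z : M) : med x y z ∈ C :=
  hC x hx y hy (med_med_self x y z).symm

theorem IsHalfSpace.compl {H : Set M} (hH : IsHalfSpace H) : IsHalfSpace Hᶜ :=
  ⟨hH.2, by rw [compl_compl]; exact hH.1⟩

theorem IsProperHalfSpace.compl {H : Set M} (hH : IsProperHalfSpace H) :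
    IsProperHalfSpace Hᶜ :=
  ⟨hH.1.compl, by simpa using hH.2.2, by simpa using hH.2.1⟩

theorem isProperHalfSpace_of_mem_separator {x y : M} {H : Set M} (h : H ∈ separator x y) :
    IsProperHalfSpace H :=
  ⟨h.1, Set.nonempty_iff_ne_empty.1 ⟨x, h.2.1⟩, fun e => h.2.2 (e ▸ Set.mem_univ y)⟩

end HalfSpaces

section Translates

variable {G : Type u} [Group G] {M : Type v} [MulAction G M]

theorem mem_orbit_compl {H J : Set M} :
    J ∈ MulAction.orbit G Hᶜ ↔ Jᶜ ∈ MulAction.orbit G H := by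
  simp only [MulAction.mem_orbit_iff, Set.smul_set_compl]
  exact exists_congr fun g => by rw [compl_eq_comm, eq_comm]

variable (G) in
/-- The translates of `H` that contain the point `x`. -/
def translatesThrough (H : Set M) (x : M) : Set (Set M) := {J | J ∈ MulAction.orbit G H ∧ x ∈ J}

theorem translatesThrough_smul (H : Set M) (g : G) (x : M) :
    translatesThrough G H (g • x) = g • translatesThrough G H x := by
  ext J
  rw [Set.mem_smul_set_iff_inv_smul_mem]
  refine and_congr ?_ Set.mem_inv_smul_set_iff.symm
  refine ⟨fun h => MulAction.mem_orbit_of_mem_orbit g⁻¹ h, fun h => ?_⟩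
  simpa using MulAction.mem_orbit_of_mem_orbit g h

theorem ncard_translatesThrough_smul (H : Set M) (g : G) (x : M) :
    (translatesThrough G H (g • x)).ncard = (translatesThrough G H x).ncard := by
  rw [translatesThrough_smul, Set.ncard_smul_set]

end Translates

/-! ### Group actions on discrete median algebras -/

section GroupActions

variable {G : Type u} [Group G] {M : Type v} [MedianAlgebra M] [MulAction G M]

theorem IsConvex.smul (hact : IsMedianAction G M) {C : Set M} (hC : IsConvex C) (g : G) :
    IsConvex (g • C) := by
  intro x hx y hy z hz
  rw [Set.mem_smul_set_iff_inv_smul_mem] at hx hy ⊢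
  refine hC _ hx _ hy ?_
  have hz' : z = med x y z := hz
  change g⁻¹ • z = med (g⁻¹ • x) (g⁻¹ • y) (g⁻¹ • z)
  rw [← hact, ← hz']

theorem IsHalfSpace.smul (hact : IsMedianAction G M) {H : Set M} (hH : IsHalfSpace H) (g : G) :
    IsHalfSpace (g • H) :=
  ⟨hH.1.smul hact g, by rw [← Set.smul_set_compl]; exact hH.2.smul hact g⟩

theorem isHalfSpace_of_mem_orbit (hact : IsMedianAction G M) {H J : Set M} (hH : IsHalfSpace H)
    (hJ : J ∈ MulAction.orbit G H) : IsHalfSpace J := by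
  obtain ⟨g, rfl⟩ := hJ
  exact hH.smul hact g

theorem separator_smul (hact : IsMedianAction G M) (g : G) (x y : M) :
    separator (g • x) (g • y) = g • separator x y := by
  ext J
  rw [Set.mem_smul_set_iff_inv_smul_mem]
  refine and_congr ⟨fun h => h.smul hact _, fun h => ?_⟩ (and_congr ?_ (not_congr ?_))
  · simpa using h.smul hact g
  all_goals rw [Set.mem_inv_smul_set_iff]

theorem dist_smul (hact : IsMedianAction G M) (g : G) (x y : M) :
    dist (g • x) (g • y) = dist x y := by
  rw [dist, separator_smul hact, dist, Set.ncard_smul_set]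

theorem translatesThrough_finite (hact : IsMedianAction G M) (hdisc : IsDiscrete M) {H : Set M}
    (hH : IsHalfSpace H) {x : M} (hx : (translatesThrough G H x).Finite) (y : M) :
    (translatesThrough G H y).Finite := by
  refine (hx.union (hdisc y x)).subset fun J hJ => ?_
  by_cases hxJ : x ∈ J
  · exact Or.inl ⟨hJ.1, hxJ⟩
  · exact Or.inr ⟨isHalfSpace_of_mem_orbit hact hH hJ.1, hJ.2, hxJ⟩

/-- The set of translates of `H` through a point `x`, viewed in the coset space of the stabilizer
of `H`, is changed by each group element by finitely many walls only, by discreteness. -/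
theorem one_lt_ends_stabilizer (hact : IsMedianAction G M) (hdisc : IsDiscrete M) {H : Set M}
    (hH : IsHalfSpace H) {x : M} (hinf : (translatesThrough G H x).Infinite)
    (hinf' : (translatesThrough G Hᶜ x).Infinite) :
    1 < GroupPair.ends (MulAction.stabilizer G H) := by
  let φ : G ⧸ MulAction.stabilizer G H → Set M := MulAction.ofQuotientStabilizer G H
  have hφ : Function.Injective φ := MulAction.injective_ofQuotientStabilizer G H
  refine GroupPair.one_lt_ends_iff.2 ⟨φ ⁻¹' {J | x ∈ J}, fun g => ?_, fun hfin => ?_,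
    fun hfin => ?_⟩
  · refine (((hdisc x (g • x)).union (hdisc (g • x) x)).preimage hφ.injOn).subset ?_
    intro q hq
    have hhalf : IsHalfSpace (φ q) :=
      isHalfSpace_of_mem_orbit hact hH (MulAction.ofQuotientStabilizer_mem_orbit G H q)
    have hg : q ∈ g • (φ ⁻¹' {J | x ∈ J}) ↔ g • x ∈ φ q := by
      rw [Set.mem_smul_set_iff_inv_smul_mem]
      change x ∈ MulAction.ofQuotientStabilizer G H (g⁻¹ • q) ↔ _
      rw [MulAction.ofQuotientStabilizer_smul, Set.mem_inv_smul_set_iff]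
    rw [Set.mem_symmDiff, hg] at hq
    exact hq.imp (fun h => ⟨hhalf, h⟩) (fun h => ⟨hhalf, h⟩)
  · refine hinf ((hfin.image φ).subset ?_)
    rintro _ ⟨⟨g, rfl⟩, hx⟩
    exact ⟨(g : G ⧸ _), hx, rfl⟩
  · refine hinf' ((hfin.image fun q => (φ q)ᶜ).subset ?_)
    rintro J ⟨hJ, hx⟩
    obtain ⟨g, hg⟩ := mem_orbit_compl.1 hJ
    refine ⟨(g : G ⧸ _), ?_, ?_⟩
    · change x ∉ g • H
      rw [show g • H = Jᶜ from hg]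
      exact not_not_intro hx
    · change (g • H)ᶜ = J
      rw [show g • H = Jᶜ from hg, compl_compl]

/-- Suppose that `H` meets every orbit and that only finitely many translates of `H` pass through
each point; let `x` be a point where their number is minimal. By the root lemma there are three
translates of `x` such that every translate of `H` containing two of them lies in a fixed set `R`
of less than minimal size, so the median of the three points lies in too few translates of `H`. -/
theorem infinite_translatesThrough (hact : IsMedianAction G M) (hdisc : IsDiscrete M)
    {H : Set M} (hH : IsHalfSpace H) (horb : (MulAction.orbit G H).Infinite)
    (hmeet : ∀ x : M, (H ∩ MulAction.orbit G x).Nonempty) (x : M) :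
    (translatesThrough G H x).Infinite := by
  classical
  intro hx
  have hfin : ∀ y : M, (translatesThrough G H y).Finite :=
    translatesThrough_finite hact hdisc hH hx
  obtain ⟨_, ⟨x₀, rfl⟩, hmin⟩ := wellFounded_lt.has_min
    (Set.range fun y => (translatesThrough G H y).ncard) ⟨_, x, rfl⟩
  let τ : G → Finset (Set M) := fun g => (hfin (g • x₀)).toFinset
  have hτ : ∀ g J, J ∈ τ g ↔ J ∈ MulAction.orbit G H ∧ g • x₀ ∈ J := fun g J =>
    (hfin (g • x₀)).mem_toFinset
  have hcard : ∀ g, (τ g).card = (translatesThrough G H x₀).ncard := fun g => by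
    rw [← Set.ncard_eq_toFinset_card _ (hfin (g • x₀)), ncard_translatesThrough_smul]
  have hinf : (Set.range τ).Infinite := by
    intro h
    refine horb ((h.biUnion fun t _ => t.finite_toSet).subset ?_)
    rintro _ ⟨g, rfl⟩
    obtain ⟨_, haH, a, rfl⟩ := hmeet x₀
    refine Set.mem_biUnion ⟨g * a, rfl⟩ ?_
    rw [Finset.mem_coe, hτ, mul_smul]
    exact ⟨⟨g, rfl⟩, Set.smul_mem_smul_set haH⟩
  obtain ⟨R, hR⟩ := exists_root_of_infinite hinf (D := (translatesThrough G H x₀).ncard)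
    (by rintro _ ⟨g, rfl⟩; exact (hcard g).le)
  obtain ⟨_, ⟨⟨g₁, rfl⟩, hR₁, -⟩, hne⟩ := ((hR ∅).sdiff (Set.finite_singleton R)).nonempty
  obtain ⟨_, ⟨g₂, rfl⟩, hR₂, hd₂⟩ := (hR (τ g₁)).nonempty
  obtain ⟨_, ⟨g₃, rfl⟩, hR₃, hd₃⟩ := (hR (τ g₁ ∪ τ g₂)).nonempty
  have hlt : R.card < (translatesThrough G H x₀).ncard := by
    rw [← hcard g₁]
    exact Finset.card_lt_card (hR₁.ssubset_of_ne fun h => hne h.symm)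
  refine hmin _ ⟨med (g₁ • x₀) (g₂ • x₀) (g₃ • x₀), rfl⟩ (lt_of_le_of_lt ?_ hlt)
  rw [← Set.ncard_coe_finset]
  refine Set.ncard_le_ncard (fun J hJ => ?_) R.finite_toSet
  have hJc := (isHalfSpace_of_mem_orbit hact hH hJ.1).2
  have h12 : g₁ • x₀ ∈ J ∨ g₂ • x₀ ∈ J := by
    by_contra! h
    exact hJc.med_mem h.1 h.2 _ hJ.2
  have h23 : g₂ • x₀ ∈ J ∨ g₃ • x₀ ∈ J := by
    by_contra! h
    exact hJc.med_mem h.1 h.2 (g₁ • x₀) (by rw [← med_rotate]; exact hJ.2)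
  have h13 : g₁ • x₀ ∈ J ∨ g₃ • x₀ ∈ J := by
    by_contra! h
    exact hJc.med_mem h.1 h.2 (g₂ • x₀) (by rw [← med_swap]; exact hJ.2)
  by_contra hJR
  have hJR' : J ∉ R := hJR
  simp only [Finset.disjoint_left, Finset.mem_sdiff, Finset.mem_union, hτ] at hd₂ hd₃
  have e2 := @hd₂ J
  have e3 := @hd₃ J
  have := hJ.1
  tauto

theorem CutsProperly.compl {H : Set M} (h : CutsProperly G H) : CutsProperly G Hᶜ := fun x => by
  rw [compl_compl]
  exact ⟨(h x).2, (h x).1⟩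

theorem CutsProperly.inter_orbit_nonempty {H : Set M} (h : CutsProperly G H) (x : M) :
    (H ∩ MulAction.orbit G x).Nonempty := by
  rw [Set.nonempty_iff_ne_empty]
  intro he
  refine (h x).1 ⟨0, fun y hy => ?_⟩
  rw [he] at hy
  exact hy.elim

theorem IsEssentialHalfSpace.compl {H : Set M} (h : IsEssentialHalfSpace G H) :
    IsEssentialHalfSpace G Hᶜ := by
  refine ⟨h.1.compl, h.2.1.compl, fun hfin => h.2.2 ((hfin.image Compl.compl).subset fun J hJ => ?_)⟩
  exact ⟨Jᶜ, mem_orbit_compl.2 (by rwa [compl_compl]), compl_compl J⟩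

theorem IsEssentialHalfSpace.infinite_translatesThrough (hact : IsMedianAction G M)
    (hdisc : IsDiscrete M) {H : Set M} (h : IsEssentialHalfSpace G H) (x : M) :
    (translatesThrough G H x).Infinite :=
  MedianAlgebra.infinite_translatesThrough hact hdisc h.1 h.2.2 h.2.1.inter_orbit_nonempty x

theorem IsEssentialHalfSpace.one_lt_ends [Nonempty M] (hact : IsMedianAction G M)
    (hdisc : IsDiscrete M) {H : Set M} (h : IsEssentialHalfSpace G H) :
    1 < GroupPair.ends (MulAction.stabilizer G H) :=
  let x := Classical.arbitrary M
  one_lt_ends_stabilizer hact hdisc h.1 (h.infinite_translatesThrough hact hdisc x)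
    (h.compl.infinite_translatesThrough hact hdisc x)

/-- In a simple median algebra the distance of two points of an orbit is at most twice the number
of translates of `H` through a point of the orbit. -/
theorem IsSimple.infinite_translatesThrough (hs : IsSimple G M)
    (hne : ¬ IsElliptic G M) {H : Set M}
    (hH : IsProperHalfSpace H) (x : M) : (translatesThrough G H x).Infinite := by
  intro hfin
  refine hne ⟨x, (translatesThrough G H x).ncard + (translatesThrough G H x).ncard, ?_⟩
  rintro _ ⟨a, rfl⟩ _ ⟨b, rfl⟩
  have hf : ∀ g : G, (translatesThrough G H (g • x)).Finite := fun g => by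
    rw [translatesThrough_smul]
    exact hfin.smul_set
  have hsub : separator (a • x) (b • x) ⊆
      translatesThrough G H (a • x) ∪ compl '' translatesThrough G H (b • x) := by
    intro J hJ
    obtain ⟨g, hg | hg⟩ := hs H J hH (isProperHalfSpace_of_mem_separator hJ)
    · exact Or.inl ⟨⟨g, hg.symm⟩, hJ.2.1⟩
    · exact Or.inr ⟨Jᶜ, ⟨⟨g, hg.symm⟩, hJ.2.2⟩, compl_compl J⟩
  calc dist (a • x) (b • x)
      ≤ (translatesThrough G H (a • x) ∪ compl '' translatesThrough G H (b • x)).ncard :=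
        Set.ncard_le_ncard hsub ((hf a).union ((hf b).image _))
    _ ≤ (translatesThrough G H (a • x)).ncard + (compl '' translatesThrough G H (b • x)).ncard :=
        Set.ncard_union_le _ _
    _ ≤ _ := by
        rw [ncard_translatesThrough_smul]
        exact Nat.add_le_add_left ((Set.ncard_image_le (hf b)).trans
          (ncard_translatesThrough_smul H b x).le) _

theorem IsSimple.one_lt_ends [Nonempty M] (hact : IsMedianAction G M) (hdisc : IsDiscrete M)
    (hs : IsSimple G M) (hne : ¬ IsElliptic G M) {H : Set M} (hH : IsProperHalfSpace H) :
    1 < GroupPair.ends (MulAction.stabilizer G H) :=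
  let x := Classical.arbitrary M
  one_lt_ends_stabilizer hact hdisc hH.1 (hs.infinite_translatesThrough hne hH x)
    (hs.infinite_translatesThrough hne hH.compl x)

/-- If `H` meets the orbit of `x` in a bounded set, then a translate `g x` far from `x` lies in
none of the infinitely many translates of `H` through `x`, against discreteness. -/
theorem IsSimple.not_isBdd_inter_orbit (hact : IsMedianAction G M) (hdisc : IsDiscrete M)
    (hs : IsSimple G M) (hne : ¬ IsElliptic G M) {H : Set M} (hH : IsProperHalfSpace H) (x : M) :
    ¬ IsBdd (H ∩ MulAction.orbit G x) := by
  rintro ⟨N, hN⟩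
  obtain ⟨g, hg⟩ : ∃ g : G, N < dist x (g • x) := by
    by_contra! h
    refine hne ⟨x, N, ?_⟩
    rintro _ ⟨a, rfl⟩ _ ⟨b, rfl⟩
    change dist (a • x) (b • x) ≤ N
    rw [← dist_smul hact a⁻¹, inv_smul_smul, ← mul_smul]
    exact h _
  refine hs.infinite_translatesThrough hne hH x ((hdisc x (g • x)).subset ?_)
  rintro J ⟨hJ, hxJ⟩
  refine ⟨isHalfSpace_of_mem_orbit hact hH.1 hJ, hxJ, fun hgJ => ?_⟩
  obtain ⟨a, rfl⟩ := hJ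
  have h := hN (a⁻¹ • x) ⟨Set.mem_smul_set_iff_inv_smul_mem.1 hxJ, a⁻¹, rfl⟩
    (a⁻¹ • g • x) ⟨Set.mem_smul_set_iff_inv_smul_mem.1 hgJ, a⁻¹ * g, mul_smul _ _ _⟩
  rw [dist_smul hact] at h
  omega

theorem IsSimple.isEssentialHalfSpace [Nonempty M] (hact : IsMedianAction G M)
    (hdisc : IsDiscrete M) (hs : IsSimple G M) (hne : ¬ IsElliptic G M) {H : Set M}
    (hH : IsProperHalfSpace H) : IsEssentialHalfSpace G H :=
  ⟨hH.1, fun x => ⟨hs.not_isBdd_inter_orbit hact hdisc hne hH x,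
    hs.not_isBdd_inter_orbit hact hdisc hne hH.compl x⟩,
    (hs.infinite_translatesThrough hne hH (Classical.arbitrary M)).mono fun _ h => h.1⟩

theorem exists_isProperHalfSpace [Nonempty M] (hne : ¬ IsElliptic G M) :
    ∃ H : Set M, IsProperHalfSpace H := by
  by_contra! h
  refine hne ⟨Classical.arbitrary M, 0, fun x _ y _ => ?_⟩
  have : separator x y = ∅ :=
    Set.eq_empty_of_forall_notMem fun J hJ => h J (isProperHalfSpace_of_mem_separator hJ)
  rw [dist, this, Set.ncard_empty]

end GroupActions

end MedianAlgebra

/-! ### The median algebra of sets commensurable to a given one -/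

/-- The subsets of `X` that differ from `V` by finitely many points. Depending on `V` it carries
an action of a group `G` acting on `X`: the hypothesis that `V` is commensurable to its translates
is passed to that instance as a `Fact`. -/
def CommensurabilityClass {X : Type*} (V : Set X) : Type _ := {U : Set X // (V ∆ U).Finite}

namespace CommensurabilityClass

open MedianAlgebra

section Median

variable {X : Type u} {V : Set X}

theorem finite_symmDiff (U W : CommensurabilityClass V) : (U.1 ∆ W.1).Finite := by
  refine (U.2.union W.2).subset ?_
  have := symmDiff_triangle U.1 V W.1
  rwa [symmDiff_comm U.1 V] at this

theorem finite_of_subset_union {U : CommensurabilityClass V} {S Y : Set X} (hY : Y.Finite)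
    (h : U.1 ∆ S ⊆ Y) : (V ∆ S).Finite :=
  (U.2.union (hY.subset h)).subset (symmDiff_triangle V U.1 S)

/-- The median of three sets is their majority set. -/
instance : MedianAlgebra (CommensurabilityClass V) where
  med U₁ U₂ U₃ := ⟨{x | (x ∈ U₁.1 ∧ x ∈ U₂.1) ∨ (x ∈ U₂.1 ∧ x ∈ U₃.1) ∨ (x ∈ U₃.1 ∧ x ∈ U₁.1)},
    finite_of_subset_union (U := U₁) ((finite_symmDiff U₁ U₂).union (finite_symmDiff U₁ U₃))
      fun x => by
        simp only [Set.mem_symmDiff, Set.mem_union, Set.mem_ofPred_eq]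
        tauto⟩
  med_swap U₁ U₂ U₃ := Subtype.ext <| Set.ext fun x => by
    simp only [Set.mem_ofPred_eq]; tauto
  med_rotate U₁ U₂ U₃ := Subtype.ext <| Set.ext fun x => by
    simp only [Set.mem_ofPred_eq]; tauto
  med_self U₁ U₂ := Subtype.ext <| Set.ext fun x => by
    simp only [Set.mem_ofPred_eq]; tauto
  med_distrib U₁ U₂ U₃ U₄ U₅ := Subtype.ext <| Set.ext fun x => by
    simp only [Set.mem_ofPred_eq]
    by_cases h₄ : x ∈ U₄.1 <;> by_cases h₅ : x ∈ U₅.1 <;> simp only [h₄, h₅] <;> tauto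

theorem mem_med {U₁ U₂ U₃ : CommensurabilityClass V} {x : X} : x ∈ (med U₁ U₂ U₃).1 ↔
    (x ∈ U₁.1 ∧ x ∈ U₂.1) ∨ (x ∈ U₂.1 ∧ x ∈ U₃.1) ∨ (x ∈ U₃.1 ∧ x ∈ U₁.1) := Iff.rfl

instance : Nonempty (CommensurabilityClass V) := ⟨⟨V, by simp⟩⟩

variable (V) in
/-- The half space of all sets containing the point `q`. -/
def coord (q : X) : Set (CommensurabilityClass V) := {U | q ∈ U.1}

theorem mem_coord {q : X} {U : CommensurabilityClass V} : U ∈ coord V q ↔ q ∈ U.1 := Iff.rfl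

theorem exists_mem_notMem (S : Set X) (hS : S.Finite) (T : Set X) (hT : T.Finite)
    (hd : Disjoint S T) : ∃ U : CommensurabilityClass V, S ⊆ U.1 ∧ Disjoint U.1 T := by
  refine ⟨⟨(V ∪ S) \ T, (hS.union hT).subset fun x => ?_⟩, fun x hx => ?_, Set.disjoint_sdiff_left⟩
  · simp only [Set.mem_symmDiff, Set.mem_union, Set.mem_sdiff]
    tauto
  · exact ⟨Or.inr hx, Set.disjoint_left.1 hd hx⟩

theorem coord_injective : Function.Injective (coord V) := by
  intro q r h
  by_contra hqr
  obtain ⟨U, hU, hU'⟩ := exists_mem_notMem (V := V) {q} (Set.finite_singleton q) {r}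
    (Set.finite_singleton r) (by simpa using hqr)
  have h1 : U ∈ coord V q := hU rfl
  rw [h] at h1
  exact Set.disjoint_left.1 hU' h1 rfl

theorem isHalfSpace_coord (q : X) : IsHalfSpace (coord V q) := by
  constructor
  · intro U hU W hW Z hZ
    have hZ' : Z = med U W Z := hZ
    rw [hZ', mem_coord, mem_med]
    exact Or.inl ⟨hU, hW⟩
  · intro U hU W hW Z hZ
    have hZ' : Z = med U W Z := hZ
    rw [Set.mem_compl_iff, mem_coord] at hU hW ⊢
    rw [hZ', mem_med]
    tauto

theorem isProperHalfSpace_coord (q : X) : IsProperHalfSpace (coord V q) := by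
  refine ⟨isHalfSpace_coord q, ?_, ?_⟩
  · obtain ⟨U, hU, -⟩ := exists_mem_notMem (V := V) {q} (Set.finite_singleton q) ∅
      Set.finite_empty (by simp)
    exact Set.nonempty_iff_ne_empty.1 ⟨U, hU rfl⟩
  · obtain ⟨U, -, hU⟩ := exists_mem_notMem (V := V) ∅ Set.finite_empty {q}
      (Set.finite_singleton q) (by simp)
    intro h
    have : U ∈ coord V q := h ▸ Set.mem_univ U
    exact Set.disjoint_left.1 hU this rfl

/-- Every proper half space `J` is a coordinate half space or the complement of one: if `A ∈ J` and
`B ∉ J` are as close as possible, then the interval between them is `{A, B}`, so that a set `U`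
belongs to `J` if and only if its median with `A` and `B` is `A`; this can be read off from any
point where `A` and `B` differ. -/
theorem exists_eq_coord {J : Set (CommensurabilityClass V)} (hJ : IsProperHalfSpace J) :
    ∃ q, J = coord V q ∨ Jᶜ = coord V q := by
  obtain ⟨A₀, hA₀⟩ := Set.nonempty_iff_ne_empty.2 hJ.2.1
  obtain ⟨B₀, hB₀⟩ := (Set.ne_univ_iff_exists_notMem _).1 hJ.2.2
  obtain ⟨⟨A, B⟩, ⟨hA : A ∈ J, hB : B ∉ J⟩, hmin⟩ :=
    (measure fun p : CommensurabilityClass V × CommensurabilityClass V =>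
      (p.1.1 ∆ p.2.1).ncard).wf.has_min {p | p.1 ∈ J ∧ p.2 ∉ J} ⟨(A₀, B₀), hA₀, hB₀⟩
  have hmin' : ∀ A' B' : CommensurabilityClass V, A' ∈ J → B' ∉ J → A'.1 ∆ B'.1 ⊆ A.1 ∆ B.1 →
      A'.1 ∆ B'.1 = A.1 ∆ B.1 := fun A' B' hA' hB' hsub =>
    Set.eq_of_subset_of_ncard_le hsub (not_lt.1 (hmin (A', B') ⟨hA', hB'⟩))
      (finite_symmDiff A B)
  have h1 : ∀ U ∈ J, med U A B = A := by
    intro U hU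
    have := hmin' (med U A B) B (hJ.1.1.med_mem hU hA B) hB fun x => by
      simp only [Set.mem_symmDiff, mem_med]
      tauto
    exact Subtype.ext (symmDiff_left_injective _ this)
  have h2 : ∀ U ∉ J, med U A B = B := by
    intro U hU
    have hm : med U A B ∉ J := by
      rw [med_swap]
      exact hJ.1.2.med_mem hU hB A
    have := hmin' A (med U A B) hA hm fun x => by
      simp only [Set.mem_symmDiff, mem_med]
      tauto
    exact Subtype.ext (symmDiff_right_injective _ this)
  obtain ⟨q, hq⟩ : (A.1 ∆ B.1).Nonempty := by
    rw [Set.symmDiff_nonempty]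
    intro h
    exact hB (Subtype.ext h ▸ hA)
  have hmem : ∀ U : CommensurabilityClass V, q ∈ U.1 ↔ q ∈ (med U A B).1 := fun U => by
    rw [mem_med]
    rw [Set.mem_symmDiff] at hq
    tauto
  refine ⟨q, hq.imp (fun hq => ?_) (fun hq => ?_)⟩
  all_goals
    ext U
    rw [mem_coord, hmem]
    by_cases hU : U ∈ J
    · simp [h1 U hU, hU, hq.1, hq.2]
    · simp [h2 U hU, hU, hq.1, hq.2]

theorem isDiscrete : IsDiscrete (CommensurabilityClass V) := by
  intro U W
  refine (((finite_symmDiff U W).image (coord V)).union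
    ((finite_symmDiff U W).image fun q => (coord V q)ᶜ)).subset fun J hJ => ?_
  obtain ⟨q, rfl | hq⟩ := exists_eq_coord (isProperHalfSpace_of_mem_separator hJ)
  · exact Or.inl ⟨q, Or.inl hJ.2, rfl⟩
  · rw [← compl_compl J, hq] at hJ
    refine Or.inr ⟨q, Or.inr ⟨not_not.1 hJ.2.2, hJ.2.1⟩, ?_⟩
    simp only [← hq, compl_compl]

theorem ncard_sdiff_le_dist (U W : CommensurabilityClass V) : (U.1 \ W.1).ncard ≤ dist U W :=
  Set.ncard_le_ncard_of_injOn (coord V) (fun q hq => ⟨isHalfSpace_coord q, hq.1, hq.2⟩)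
    coord_injective.injOn (isDiscrete U W)

end Median

section Action

variable {G : Type u} [Group G] {X : Type u} [MulAction G X] {V : Set X}
  [hV : Fact (∀ g : G, (V ∆ (g • V)).Finite)]

instance : MulAction G (CommensurabilityClass V) where
  smul g U := ⟨g • U.1, ((hV.out g).union (U.2.smul_set (a := g))).subset (by
    rw [Set.smul_set_symmDiff]
    exact symmDiff_triangle V (g • V) (g • U.1))⟩
  one_smul U := Subtype.ext (one_smul G U.1)
  mul_smul g h U := Subtype.ext (mul_smul g h U.1)

theorem coe_smul (g : G) (U : CommensurabilityClass V) : (g • U).1 = g • U.1 := rfl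

variable (G V) in
theorem isMedianAction : IsMedianAction G (CommensurabilityClass V) := by
  intro g U₁ U₂ U₃
  refine Subtype.ext (Set.ext fun x => ?_)
  simp only [coe_smul, mem_med, Set.mem_smul_set_iff_inv_smul_mem]

theorem smul_coord (g : G) (q : X) : g • coord V q = coord V (g • q) := by
  ext U
  rw [Set.mem_smul_set_iff_inv_smul_mem, mem_coord, mem_coord, coe_smul,
    Set.mem_inv_smul_set_iff]

theorem stabilizer_coord (q : X) :
    MulAction.stabilizer G (coord V q) = MulAction.stabilizer G q := by
  ext g
  rw [MulAction.mem_stabilizer_iff, MulAction.mem_stabilizer_iff, smul_coord,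
    coord_injective.eq_iff]

variable [MulAction.IsPretransitive G X]

variable (G V) in
theorem isSimple : IsSimple G (CommensurabilityClass V) := by
  intro H J hH hJ
  obtain ⟨q, hq⟩ := exists_eq_coord hH
  obtain ⟨r, hr⟩ := exists_eq_coord hJ
  obtain ⟨g, hg⟩ := MulAction.exists_smul_eq G q r
  have h : g • coord V q = coord V r := by rw [smul_coord, hg]
  refine ⟨g, ?_⟩
  rcases hq with hq | hq <;> rcases hr with hr | hr <;> rw [← hq, ← hr] at h
  · exact Or.inl h.symm
  · exact Or.inr h.symm
  · rw [Set.smul_set_compl] at h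
    exact Or.inr (compl_eq_comm.1 h)
  · rw [Set.smul_set_compl, compl_inj_iff] at h
    exact Or.inl h.symm

theorem not_isElliptic (hinf : V.Infinite) (hinf' : Vᶜ.Infinite) :
    ¬ IsElliptic G (CommensurabilityClass V) := by
  rintro ⟨U, N, hN⟩
  obtain ⟨W, hW, hinv⟩ := exists_invariant_of_bounded (G := G) (N + N) U.1 fun g => by
    have h1 := (ncard_sdiff_le_dist U (g • U)).trans
      (hN U (MulAction.mem_orbit_self U) (g • U) (MulAction.mem_orbit U g))
    have h2 := (ncard_sdiff_le_dist (g • U) U).trans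
      (hN (g • U) (MulAction.mem_orbit U g) U (MulAction.mem_orbit_self U))
    have hfin := finite_symmDiff U (g • U)
    rw [← coe_smul, ← hfin.cast_ncard_eq, Nat.cast_le]
    exact (Set.ncard_union_le _ _).trans (Nat.add_le_add h1 h2)
  have hVW : (V ∆ W).Finite := finite_of_subset_union hW subset_rfl
  obtain rfl | ⟨q, hq⟩ := W.eq_empty_or_nonempty
  · exact hinf (by rwa [← Set.bot_eq_empty, symmDiff_bot] at hVW)
  · refine hinf' (hVW.subset fun x hx => Or.inr ⟨?_, hx⟩)
    obtain ⟨g, rfl⟩ := MulAction.exists_smul_eq G q x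
    rw [← hinv g]
    exact Set.smul_mem_smul_set hq

end Action

end CommensurabilityClass

open MedianAlgebra in
/-- The median algebra is the commensurability class of a set `V ⊆ G ⧸ K` witnessing
`e(G, K) > 1`, and the half space is the coordinate at the coset `K`, whose stabilizer is `K`. -/
theorem exists_simple_of_one_lt_ends {G : Type u} [Group G] {K : Subgroup G}
    (hK : 1 < GroupPair.ends K) :
    ∃ (M : Type u) (_ : MedianAlgebra M) (_ : MulAction G M),
      Nonempty M ∧ IsMedianAction G M ∧ IsDiscrete M ∧ IsSimple G M ∧ ¬ IsElliptic G M ∧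
        ∃ H : Set M, IsProperHalfSpace H ∧ IsEssentialHalfSpace G H ∧
          MulAction.stabilizer G H = K := by
  obtain ⟨V, hV, hinf, hinf'⟩ := GroupPair.one_lt_ends_iff.1 hK
  have : Fact (∀ g : G, (V ∆ (g • V)).Finite) := ⟨hV⟩
  have hact := CommensurabilityClass.isMedianAction G V
  have hs := CommensurabilityClass.isSimple G V
  have hne := CommensurabilityClass.not_isElliptic (G := G) hinf hinf'
  have hH := CommensurabilityClass.isProperHalfSpace_coord (V := V) ((1 : G) : G ⧸ K)
  refine ⟨CommensurabilityClass V, inferInstance, inferInstance, inferInstance, hact,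
    CommensurabilityClass.isDiscrete, hs, hne, _, hH,
    hs.isEssentialHalfSpace hact CommensurabilityClass.isDiscrete hne hH, ?_⟩
  rw [CommensurabilityClass.stabilizer_coord, MulAction.stabilizer_quotient]

/-! ### The equivalences -/

theorem theorem11p5 (G : Type u) [Group G] :
    List.TFAE [
      ∃ K : Subgroup G, 1 < GroupPair.ends K,
      ∃ (M : Type u) (_ : MedianAlgebra M) (_ : MulAction G M),
        Nonempty M ∧ MedianAlgebra.IsMedianAction G M ∧ MedianAlgebra.IsDiscrete M ∧
          MedianAlgebra.IsSimple G M ∧ ¬ MedianAlgebra.IsElliptic G M,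
      ∃ (M : Type u) (_ : MedianAlgebra M) (_ : MulAction G M),
        Nonempty M ∧ MedianAlgebra.IsMedianAction G M ∧ MedianAlgebra.IsDiscrete M ∧
          MedianAlgebra.IsEssential G M] ∧
    (∀ (M : Type v) [MedianAlgebra M] [MulAction G M] [Nonempty M],
      MedianAlgebra.IsMedianAction G M → MedianAlgebra.IsDiscrete M →
      (MedianAlgebra.IsSimple G M → ¬ MedianAlgebra.IsElliptic G M →
        ∀ H : Set M, MedianAlgebra.IsProperHalfSpace H →
          1 < GroupPair.ends (MulAction.stabilizer G H)) ∧
      (∀ H : Set M, MedianAlgebra.IsEssentialHalfSpace G H →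
          1 < GroupPair.ends (MulAction.stabilizer G H))) ∧
    (∀ K : Subgroup G, 1 < GroupPair.ends K →
      ∃ (M : Type u) (_ : MedianAlgebra M) (_ : MulAction G M),
        Nonempty M ∧ MedianAlgebra.IsMedianAction G M ∧ MedianAlgebra.IsDiscrete M ∧
          MedianAlgebra.IsSimple G M ∧ ¬ MedianAlgebra.IsElliptic G M ∧
          ∃ H : Set M, MedianAlgebra.IsProperHalfSpace H ∧
            MedianAlgebra.IsEssentialHalfSpace G H ∧
            K ≤ MulAction.stabilizer G H ∧
            (K.subgroupOf (MulAction.stabilizer G H)).FiniteIndex) := by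
  refine ⟨?_, ?_, ?_⟩
  · tfae_have 1 → 2 := by
      rintro ⟨K, hK⟩
      obtain ⟨M, iM, iG, hM, hact, hdisc, hs, hne, -⟩ := exists_simple_of_one_lt_ends hK
      exact ⟨M, iM, iG, hM, hact, hdisc, hs, hne⟩
    tfae_have 1 → 3 := by
      rintro ⟨K, hK⟩
      obtain ⟨M, iM, iG, hM, hact, hdisc, -, -, H, -, hH, -⟩ := exists_simple_of_one_lt_ends hK
      exact ⟨M, iM, iG, hM, hact, hdisc, H, hH⟩
    tfae_have 2 → 1 := by
      rintro ⟨M, iM, iG, hM, hact, hdisc, hs, hne⟩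
      obtain ⟨H, hH⟩ := MedianAlgebra.exists_isProperHalfSpace hne
      exact ⟨_, hs.one_lt_ends hact hdisc hne hH⟩
    tfae_have 3 → 1 := by
      rintro ⟨M, iM, iG, hM, hact, hdisc, H, hH⟩
      exact ⟨_, hH.one_lt_ends hact hdisc⟩
    tfae_finish
  · intro M _ _ _ hact hdisc
    exact ⟨fun hs hne H hH => hs.one_lt_ends hact hdisc hne hH,
      fun H hH => hH.one_lt_ends hact hdisc⟩
  · intro K hK
    obtain ⟨M, iM, iG, hM, hact, hdisc, hs, hne, H, hp, he, rfl⟩ :=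
      exists_simple_of_one_lt_ends hK
    refine ⟨M, iM, iG, hM, hact, hdisc, hs, hne, H, hp, he, le_rfl, ?_⟩
    rw [Subgroup.subgroupOf_self]
    infer_instance
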